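/- Let $d\ge 0$, let $H$ be a locally compact Hausdorff abelian group, written additively, and let $\Lambda\subseteq\mathbb R^d\times H$ be a subgroup such that the quotient $(\mathbb R^d\times H)/\Lambda$ is compact. Let $\pi:\mathbb R^d\times H\to\mathbb R^d$ and $\pi':\mathbb R^d\times H\to H$ be the projections, let $K\subseteq H$ be non-empty and relatively compact, and let $$\mathcal D_K=\{\pi(x) : x\in\Lambda,\ \pi'(x)\in K\}$$ be the model set with acceptance domain $K$. Assume that (i) the restriction of $\pi$ to $\Lambda$ is injective; (ii) the restriction of $\pi'$ to $\Lambda$ is injective; (iii) $G=\pi'(\Lambda)$ is dense in $H$; (iv) $K$ is the closure of its interior. Assume further that $H$ is connected and simply connected, and that $K$ contains an open path-connected set $V$ with $0\in V\subseteq K\subseteq\bigcup_{s\in V}(s+V)$. Then the universal group of the point-set semigroup $\Gamma(\mathcal D_K)$ is isomorphic to $G$. Here, for $\mathcal D\subseteq\mathbb R^d$, $\Gamma(\mathcal D)$ is the following set with a partial binary operation. Let $C(\mathcal D)$ be the set of triples $(p_2,P,p_1)$ with $P\subseteq\mathcal D$ finite and $p_1,p_2\in P$, with the partial product $(p_2,P,p_1)(q_2,Q,q_1)=(p_2,P\cup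 Q,q_1)$, defined if and only if $p_1=q_2$. For $g\in\mathbb R^d$ put $g\cdot(p_2,P,p_1)=(g+p_2,g+P,g+p_1)$, defined if and only if $g+P\subseteq\mathcal D$. Then $\Gamma(\mathcal D)$ is the set of classes $[x]$ of elements $x\in C(\mathcal D)$ under the equivalence relation $x\sim y$ if and only if $y=g\cdot x$ for some $g$, with the product $[x][y]=[(g\cdot x)(h\cdot y)]$, defined if and only if there are $g,h\in\mathbb R^d$ such that $(g\cdot x)(h\cdot y)$ is defined. The universal group of a set $S$ with a partial binary operation is the group generated by the set $S$ subject to the relations $s\cdot t=st$ for all $s,t\in S$ for which the product $st$ is defined in $S$. -/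

import Mathlib

open scoped Pointwise

/-- A set equipped with a partial binary operation: `pmul s t` is a partial value, whose domain
expresses that the product of `s` and `t` is defined. -/
class PartialMul (S : Type*) where
  pmul : S → S → Part S

/-- The universal group of a set with a partial binary operation: the free group on `S` modulo
the congruence generated by `(s) * (t) = (s ∘ t)`, for all `s`, `t` such that `s ∘ t` is
defined. -/
abbrev UniversalGroup (S : Type*) [PartialMul S] : Type _ :=
  PresentedGroup {r : FreeGroup S | ∃ s t u : S, u ∈ PartialMul.pmul s t ∧
    r = FreeGroup.of s * FreeGroup.of t * (FreeGroup.of u)⁻¹}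

/-- The category `C(D)` of a point-set `D`: the triples `(p₂, P, p₁)` with `P` a finite subset of
`D` and `p₁, p₂ ∈ P`. -/
@[ext]
structure PointedPattern {E : Type*} (D : Set E) where
  left : E
  pattern : Set E
  right : E
  finite : pattern.Finite
  subset : pattern ⊆ D
  left_mem : left ∈ pattern
  right_mem : right ∈ pattern

namespace PointedPattern

variable {E : Type*} {D : Set E}

/-- The partial product `(p₂, P, p₁) ∘ (q₂, Q, q₁) = (p₂, P ∪ Q, q₁)`, defined iff `p₁ = q₂`. -/
def comp (x y : PointedPattern D) : Part (PointedPattern D) where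
  Dom := x.right = y.left
  get _ :=
    { left := x.left
      pattern := x.pattern ∪ y.pattern
      right := y.right
      finite := x.finite.union y.finite
      subset := Set.union_subset x.subset y.subset
      left_mem := Or.inl x.left_mem
      right_mem := Or.inr y.right_mem }

theorem mem_comp_iff {x y z : PointedPattern D} :
    z ∈ comp x y ↔ x.right = y.left ∧
      z.left = x.left ∧ z.pattern = x.pattern ∪ y.pattern ∧ z.right = y.right := by
  constructor
  · rintro ⟨h, rfl⟩
    exact ⟨h, rfl, rfl, rfl⟩
  · rintro ⟨h, h₁, h₂, h₃⟩
    exact ⟨h, PointedPattern.ext h₁.symm h₂.symm h₃.symm⟩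

variable [AddCommGroup E]

/-- The partial action by translations: `g · (p₂, P, p₁) = (g + p₂, g + P, g + p₁)`, defined iff
`g + P ⊆ D`. -/
def translate (g : E) (x : PointedPattern D) : Part (PointedPattern D) where
  Dom := g +ᵥ x.pattern ⊆ D
  get h :=
    { left := g + x.left
      pattern := g +ᵥ x.pattern
      right := g + x.right
      finite := x.finite.vadd_set
      subset := h
      left_mem := Set.vadd_mem_vadd_set x.left_mem
      right_mem := Set.vadd_mem_vadd_set x.right_mem }

theorem mem_translate_iff {g : E} {x y : PointedPattern D} :
    y ∈ translate g x ↔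
      y.left = g + x.left ∧ y.pattern = g +ᵥ x.pattern ∧ y.right = g + x.right := by
  constructor
  · rintro ⟨h, rfl⟩
    exact ⟨rfl, rfl, rfl⟩
  · rintro ⟨h₁, h₂, h₃⟩
    exact ⟨by change g +ᵥ x.pattern ⊆ D; rw [← h₂]; exact y.subset,
      PointedPattern.ext h₁.symm h₂.symm h₃.symm⟩

/-- Two triples are equivalent iff one is a translate of the other. -/
def translateSetoid (D : Set E) : Setoid (PointedPattern D) where
  r x y := ∃ g : E, y ∈ translate g x
  iseqv :=
    { refl := fun x => ⟨0, mem_translate_iff.2 (by simp)⟩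
      symm := by
        rintro x y ⟨g, h⟩
        obtain ⟨h₁, h₂, h₃⟩ := mem_translate_iff.1 h
        exact ⟨-g, mem_translate_iff.2 (by simp [h₁, h₂, h₃])⟩
      trans := by
        rintro x y z ⟨g, h⟩ ⟨k, h'⟩
        obtain ⟨h₁, h₂, h₃⟩ := mem_translate_iff.1 h
        obtain ⟨k₁, k₂, k₃⟩ := mem_translate_iff.1 h'
        exact ⟨k + g, mem_translate_iff.2
          (by simp [h₁, h₂, h₃, k₁, k₂, k₃, add_assoc, add_vadd])⟩ }

end PointedPattern

/-- The point-set semigroup `Γ(D)` of a point-set `D`: the triples `(p₂, P, p₁)` up to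
translation. -/
def PointSetSemigroup {E : Type*} [AddCommGroup E] (D : Set E) : Type _ :=
  Quotient (PointedPattern.translateSetoid D)

namespace PointSetSemigroup

open PointedPattern

variable {E : Type*} [AddCommGroup E] {D : Set E}

/-- The class of a triple. -/
def mk (x : PointedPattern D) : PointSetSemigroup D :=
  Quotient.mk (translateSetoid D) x

theorem mk_eq_iff {x y : PointedPattern D} : mk x = mk y ↔ ∃ g : E, y ∈ translate g x :=
  Quotient.eq (r := translateSetoid D)

/-- `c` is a product of `a` and `b`: there are representatives `x` of `a` and `y` of `b` such that
`x ∘ y` is defined and represents `c`. -/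
def IsProd (a b c : PointSetSemigroup D) : Prop :=
  ∃ x y z : PointedPattern D, mk x = a ∧ mk y = b ∧ z ∈ comp x y ∧ mk z = c

/-- The product does not depend on the choice of composable representatives. -/
theorem IsProd.unique {a b c c' : PointSetSemigroup D} (h : IsProd a b c) (h' : IsProd a b c') :
    c = c' := by
  obtain ⟨x, y, z, hx, hy, hz, rfl⟩ := h
  obtain ⟨x', y', z', hx', hy', hz', rfl⟩ := h'
  obtain ⟨g, hg⟩ := mk_eq_iff.1 (hx.trans hx'.symm)
  obtain ⟨k, hk⟩ := mk_eq_iff.1 (hy.trans hy'.symm)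
  obtain ⟨g₁, g₂, g₃⟩ := mem_translate_iff.1 hg
  obtain ⟨k₁, k₂, k₃⟩ := mem_translate_iff.1 hk
  obtain ⟨e, z₁, z₂, z₃⟩ := mem_comp_iff.1 hz
  obtain ⟨e', z₁', z₂', z₃'⟩ := mem_comp_iff.1 hz'
  have hgk : g = k := by
    rw [g₃, k₁, e] at e'
    exact add_right_cancel e'
  subst hgk
  refine mk_eq_iff.2 ⟨g, mem_translate_iff.2 ⟨?_, ?_, ?_⟩⟩
  · rw [z₁', z₁, g₁]
  · rw [z₂', z₂, g₂, k₂, Set.vadd_set_union]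
  · rw [z₃', z₃, k₃]

/-- The partial product of `Γ(D)`: `[x][y] = [(g · x) ∘ (h · y)]`, defined iff there are
translations `g`, `h` such that `(g · x) ∘ (h · y)` is defined. -/
noncomputable instance : PartialMul (PointSetSemigroup D) where
  pmul a b := ⟨∃ c, IsProd a b c, fun h => h.choose⟩

theorem mem_pmul_iff {a b c : PointSetSemigroup D} :
    c ∈ PartialMul.pmul a b ↔ IsProd a b c := by
  constructor
  · rintro ⟨h, rfl⟩
    exact h.choose_spec
  · intro h
    exact ⟨⟨c, h⟩, IsProd.unique (Exists.choose_spec (⟨c, h⟩ : ∃ c, IsProd a b c)) h⟩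

end PointSetSemigroup

/-- The model set `{π(x) | x ∈ Λ, π'(x) ∈ K}` with acceptance domain `K`, where `π` and `π'` are
the projections of `E × H` onto its factors. -/
def modelSet {E H : Type*} [AddCommGroup E] [AddCommGroup H] (Λ : AddSubgroup (E × H))
    (K : Set H) : Set E :=
  {y | ∃ x ∈ Λ, x.2 ∈ K ∧ x.1 = y}

/-! The map sending `x ∈ Λ` with `π' x ∈ V` to the class of `(π x, {π x, 0}, 0)` is a local
homomorphism from `Λ` to the universal group `U`. A local homomorphism is the cocycle of a covering
of `H` with fibre `U`, on which `Λ × U` acts. As `H` is simply connected, each path component meets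
each fibre at most once, so the stabilizer of the path component of the base point is the graph of a
homomorphism, which extends the local one. It is onto because `K ⊆ ⋃ s ∈ V, s + V` and the density
of `π' Λ` let every class be written in terms of those of the `(π x, {π x, 0}, 0)`, and one-to-one
because `[p₂, P, p₁] ↦ p₂ - p₁` recovers `π x`. -/

theorem eq_of_joined_of_isCoveringMap {Z X : Type*} [TopologicalSpace Z] [TopologicalSpace X]
    [SimplyConnectedSpace X] {p : Z → X} (hp : IsCoveringMap p) {z z' : Z} (h : Joined z z')
    (hz : p z = p z') : z = z' := by
  have lift_loop := hp.monodromy_eq_of_map_eq (γ := .refl (p z')) (ex := ⟨z, hz⟩)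
    (ey := ⟨z', rfl⟩) (.mk h.somePath) (Subsingleton.elim _ _)
  rw [hp.monodromy_refl] at lift_loop
  exact congrArg Subtype.val lift_loop

/-- The stabilizer of the path component of `z` under an action by homeomorphisms. -/
def pathComponentStabilizer (G : Type*) {Z : Type*} [Group G] [TopologicalSpace Z] [MulAction G Z]
    [ContinuousConstSMul G Z] (z : Z) : Subgroup G where
  carrier := {g | Joined z (g • z)}
  one_mem' := by simpa using Joined.refl z
  mul_mem' {g h} hg hh := by
    simpa only [Set.mem_ofPred_eq, mul_smul] using hg.trans (hh.map (continuous_const_smul g))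
  inv_mem' {g} hg := by
    simpa using (hg.map (continuous_const_smul g⁻¹)).symm

theorem mem_pathComponentStabilizer {G Z : Type*} [Group G] [TopologicalSpace Z] [MulAction G Z]
    [ContinuousConstSMul G Z] {z : Z} {g : G} :
    g ∈ pathComponentStabilizer G z ↔ Joined z (g • z) :=
  Iff.rfl

theorem closure_preimage_eq_top_of_denseRange {A H : Type*} [Group A] [Group H] [TopologicalSpace H]
    [IsTopologicalGroup H] [ConnectedSpace H] {ι : A →* H} (hι : DenseRange ι) {V : Set H}
    (hV : IsOpen V) (hV1 : 1 ∈ V) : Subgroup.closure (ι ⁻¹' V) = ⊤ := by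
  set B := Subgroup.closure (ι ⁻¹' V)
  have V_subset : V ⊆ (B.map ι).topologicalClosure :=
    (hι.open_subset_closure_inter hV).trans <| closure_mono <| by
      rintro _ ⟨hv, a, rfl⟩
      exact ⟨a, Subgroup.subset_closure hv, rfl⟩
  have isOpen_closure : IsOpen ((B.map ι).topologicalClosure : Set H) :=
    Subgroup.isOpen_of_mem_nhds _ (Filter.mem_of_superset (hV.mem_nhds hV1) V_subset)
  have dense : Dense (B.map ι : Set H) := dense_iff_closure_eq.2 <|
    IsClopen.eq_univ ⟨isClosed_closure, isOpen_closure⟩ ⟨1, subset_closure (one_mem _)⟩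
  refine eq_top_iff.2 fun a _ => ?_
  obtain ⟨_, ⟨b, hb, rfl⟩, hab⟩ := dense.exists_mem_open
    (hV.preimage (by fun_prop : Continuous fun h => ι a / h)) ⟨ι a, by simpa⟩
  have a_div_b_mem : a / b ∈ B := Subgroup.subset_closure (by simpa using hab)
  simpa using B.mul_mem a_div_b_mem hb

/-- A local homomorphism to `U`, defined on the part of `A` that `ι : A →* H` maps into an open
neighbourhood `domain` of `1`. It is encoded as a total function on `A`, whose values outside
`ι ⁻¹' domain` are irrelevant. -/
structure LocalGroupHom {A H : Type*} [Group A] [Group H] [TopologicalSpace H] (ι : A →* H)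
    (U : Type*) [Group U] where
  domain : Set H
  isOpen_domain : IsOpen domain
  one_mem_domain : 1 ∈ domain
  toFun : A → U
  map_mul' : ∀ x y, ι x ∈ domain → ι y ∈ domain → ι (x * y) ∈ domain →
    toFun (x * y) = toFun x * toFun y

namespace LocalGroupHom

variable {A H U : Type*} [Group A] [Group H] [TopologicalSpace H] [Group U] {ι : A →* H}

instance : CoeFun (LocalGroupHom ι U) fun _ => A → U := ⟨toFun⟩

variable (φ : LocalGroupHom ι U)

theorem map_mul {x y : A} (hx : ι x ∈ φ.domain) (hy : ι y ∈ φ.domain)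
    (hxy : ι (x * y) ∈ φ.domain) : φ (x * y) = φ x * φ y :=
  φ.map_mul' x y hx hy hxy

theorem map_one : φ 1 = 1 := by
  simpa using φ.map_mul (x := 1) (y := 1) (by simpa using φ.one_mem_domain)
    (by simpa using φ.one_mem_domain) (by simpa using φ.one_mem_domain)

variable [IsTopologicalGroup H]

theorem exists_nhds_one_div_mem_domain :
    ∃ W ∈ nhds (1 : H), ∀ v ∈ W, ∀ w ∈ W, v / w ∈ φ.domain :=
  exists_nhds_split_inv (φ.isOpen_domain.mem_nhds φ.one_mem_domain)

/-- The left translate by `ι a` of an open neighbourhood `W` of `1` such that `W / W ⊆ domain`. -/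
def chart (a : A) : Set H :=
  {h | (ι a)⁻¹ * h ∈ interior φ.exists_nhds_one_div_mem_domain.choose}

theorem isOpen_chart (a : A) : IsOpen (φ.chart a) :=
  isOpen_interior.preimage (continuous_const_mul _)

theorem map_mem_chart (a : A) : ι a ∈ φ.chart a := by
  simpa [chart, mem_interior_iff_mem_nhds] using φ.exists_nhds_one_div_mem_domain.choose_spec.1

theorem mul_mem_chart_mul {x a : A} {h : H} : ι x * h ∈ φ.chart (x * a) ↔ h ∈ φ.chart a := by
  simp [chart, mul_assoc]

variable {φ} in
theorem map_inv_mul_mem_domain {a b : A} {h : H} (ha : h ∈ φ.chart a) (hb : h ∈ φ.chart b) :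
    ι (a⁻¹ * b) ∈ φ.domain := by
  simpa using φ.exists_nhds_one_div_mem_domain.choose_spec.2 _ (interior_subset ha) _
    (interior_subset hb)

variable {φ} in
theorem map_inv_mul_mul_map_inv_mul {a b c : A} {h : H} (ha : h ∈ φ.chart a) (hb : h ∈ φ.chart b)
    (hc : h ∈ φ.chart c) : φ (a⁻¹ * b) * φ (b⁻¹ * c) = φ (a⁻¹ * c) := by
  have mul_eq : a⁻¹ * b * (b⁻¹ * c) = a⁻¹ * c := by group
  rw [← mul_eq, φ.map_mul (map_inv_mul_mem_domain ha hb) (map_inv_mul_mem_domain hb hc)]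
  exact mul_eq ▸ map_inv_mul_mem_domain ha hc

theorem exists_mem_chart (hι : DenseRange ι) {s : Set H} (hs : IsOpen s) {h : H} (hh : h ∈ s) :
    ∃ a, ι a ∈ s ∧ h ∈ φ.chart a := by
  refine hι.exists_mem_open (s := s ∩ {k | k⁻¹ * h ∈ interior _})
    (hs.inter (isOpen_interior.preimage (by fun_prop))) ⟨h, hh, ?_⟩
  simpa [mem_interior_iff_mem_nhds] using φ.exists_nhds_one_div_mem_domain.choose_spec.1

section Covering

variable [TopologicalSpace U] [DiscreteTopology U] (hι : DenseRange ι)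

/-- The covering of `H` with fibre `U` that is trivial over each `φ.chart a` and whose transition
functions are the right multiplications by values of `φ`. -/
noncomputable def bundle : FiberBundleCore A H U where
  baseSet := φ.chart
  isOpen_baseSet := φ.isOpen_chart
  indexAt h := (φ.exists_mem_chart hι isOpen_univ (Set.mem_univ h)).choose
  mem_baseSet_at h := (φ.exists_mem_chart hι isOpen_univ (Set.mem_univ h)).choose_spec.2
  coordChange a b _ u := u * φ (a⁻¹ * b)
  coordChange_self a _ _ u := by rw [inv_mul_cancel, φ.map_one, mul_one]
  continuousOn_coordChange a b := by fun_prop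
  coordChange_comp a b c _ hh u := by
    rw [mul_assoc, map_inv_mul_mul_map_inv_mul hh.1.1 hh.1.2 hh.2]

/-- The total space of the covering `φ.bundle hι`. -/
abbrev Cover : Type _ := (φ.bundle hι).TotalSpace

namespace Cover

/-- The point over `h ∈ φ.chart a` with coordinate `u` in the chart at `a`. -/
noncomputable def point (a : A) (h : H) (u : U) : φ.Cover hι :=
  ⟨h, u * φ (a⁻¹ * (φ.bundle hι).indexAt h)⟩

variable {φ hι}

theorem mem_chart_indexAt (h : H) : h ∈ φ.chart ((φ.bundle hι).indexAt h) :=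
  (φ.bundle hι).mem_baseSet_at h

theorem isCoveringMap_proj : IsCoveringMap (φ.bundle hι).proj :=
  FiberBundle.isCoveringMap (F := U) (E := (φ.bundle hι).Fiber)

theorem point_eq_point {a b : A} {h : H} (ha : h ∈ φ.chart a) (hb : h ∈ φ.chart b) (u : U) :
    point φ hι a h u = point φ hι b h (u * φ (a⁻¹ * b)) := by
  rw [point, point, mul_assoc, map_inv_mul_mul_map_inv_mul ha hb (mem_chart_indexAt h)]

theorem point_injective (a : A) (h : H) : Function.Injective (point φ hι a h) := fun _ _ huv =>
  mul_right_cancel (eq_of_heq (Bundle.TotalSpace.mk.inj huv).2)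

variable (φ hι) in
/-- The coordinate in the chart at `a` of a point `z` over `φ.chart a`. -/
noncomputable def coord (a : A) (z : φ.Cover hι) : U := ((φ.bundle hι).localTriv a z).2

theorem point_coord {z : φ.Cover hι} {a : A} (ha : z.1 ∈ φ.chart a) :
    point φ hι a z.1 (coord φ hι a z) = z :=
  ((φ.bundle hι).localTriv a).toPartialEquiv.left_inv ha

theorem coord_point {a b : A} {h : H} (ha : h ∈ φ.chart a) (hb : h ∈ φ.chart b) (u : U) :
    coord φ hι b (point φ hι a h u) = u * φ (a⁻¹ * b) :=
  point_injective b h <| (point_coord (z := point φ hι a h u) hb).trans (point_eq_point ha hb u)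

theorem continuousAt_coord {z : φ.Cover hι} {a : A} (ha : z.1 ∈ φ.chart a) :
    ContinuousAt (coord φ hι a) z :=
  continuous_snd.continuousAt.comp (((φ.bundle hι).localTriv a).continuousAt ha)

theorem continuousAt_point {X : Type*} [TopologicalSpace X] {a : A} {h : X → H} {u : X → U} {x : X}
    (ha : h x ∈ φ.chart a) (hh : ContinuousAt h x) (hu : ContinuousAt u x) :
    ContinuousAt (fun x => point φ hι a (h x) (u x)) x := by
  have continuousAt_symm :=
    ((φ.bundle hι).localTriv a).toOpenPartialHomeomorph.continuousAt_symm
      (x := (h x, u x)) (((φ.bundle hι).mem_localTriv_target a _).2 ha)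
  exact continuousAt_symm.comp (f := fun x => (h x, u x)) (hh.prodMk hu)

/-- `x : A` translates the base by `ι x`, and `u : U` multiplies coordinates on the left, which
commutes with the transition functions. -/
noncomputable instance : SMul (A × U) (φ.Cover hι) where
  smul g z :=
    let a := (φ.bundle hι).indexAt z.1
    point φ hι (g.1 * a) (ι g.1 * z.1) (g.2 * coord φ hι a z)

theorem smul_point (g : A × U) {a : A} {h : H} (ha : h ∈ φ.chart a) (u : U) :
    g • point φ hι a h u = point φ hι (g.1 * a) (ι g.1 * h) (g.2 * u) := by
  have hb : h ∈ φ.chart ((φ.bundle hι).indexAt h) := mem_chart_indexAt h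
  rw [point_eq_point (φ.mul_mem_chart_mul.2 ha) (φ.mul_mem_chart_mul.2 hb), mul_inv_rev, mul_assoc,
    mul_assoc, inv_mul_cancel_left, ← coord_point ha hb]
  rfl

noncomputable instance : MulAction (A × U) (φ.Cover hι) where
  one_smul z := by
    have hz := mem_chart_indexAt (φ := φ) (hι := hι) z.1
    rw [← point_coord hz, smul_point _ hz]
    simp
  mul_smul g g' z := by
    have hz := mem_chart_indexAt (φ := φ) (hι := hι) z.1
    rw [← point_coord hz, smul_point _ hz, smul_point _ hz, smul_point _ (φ.mul_mem_chart_mul.2 hz)]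
    simp [mul_assoc]

instance : ContinuousConstSMul (A × U) (φ.Cover hι) where
  continuous_const_smul g := by
    refine continuous_iff_continuousAt.2 fun z => ?_
    set a := (φ.bundle hι).indexAt z.1
    have hz : z.1 ∈ φ.chart a := mem_chart_indexAt z.1
    have continuousAt_proj : ContinuousAt (fun z' : φ.Cover hι => z'.1) z :=
      (φ.bundle hι).continuous_proj.continuousAt
    have continuousAt_smul_coord : ContinuousAt (fun z' => g.2 * coord φ hι a z') z :=
      (continuous_of_discreteTopology (f := (g.2 * ·))).continuousAt.comp (continuousAt_coord hz)
    have continuousAt_local : ContinuousAt (fun z' : φ.Cover hι =>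
        point φ hι (g.1 * a) (ι g.1 * z'.1) (g.2 * coord φ hι a z')) z :=
      continuousAt_point (φ.mul_mem_chart_mul.2 hz) (continuousAt_proj.const_mul (ι g.1))
        continuousAt_smul_coord
    refine continuousAt_local.congr ?_
    filter_upwards [continuousAt_proj ((φ.isOpen_chart a).mem_nhds hz)] with z' hz'
    rw [← smul_point _ hz', point_coord hz']

theorem exists_section :
    ∃ s : H → φ.Cover hι, ∀ h, ∀ a, ι a ∈ φ.domain → h ∈ φ.chart a →
      s h = point φ hι a h (φ a) := by
  suffices ∀ h, ∃ z, ∀ a, ι a ∈ φ.domain → h ∈ φ.chart a → z = point φ hι a h (φ a) from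
    Classical.skolem.1 this
  intro h
  by_cases hh : ∃ a, ι a ∈ φ.domain ∧ h ∈ φ.chart a
  · obtain ⟨a, ha, hha⟩ := hh
    refine ⟨point φ hι a h (φ a), fun b hb hhb => ?_⟩
    rw [point_eq_point hha hhb, ← φ.map_mul ha (map_inv_mul_mem_domain hha hhb) (by simpa),
      mul_inv_cancel_left]
  · exact ⟨point φ hι 1 h 1, fun a ha hha => (hh ⟨a, ha, hha⟩).elim⟩

theorem exists_continuousOn_section :
    ∃ s : H → φ.Cover hι, ContinuousOn s φ.domain ∧
      ∀ a, ι a ∈ φ.domain → s (ι a) = point φ hι a (ι a) (φ a) := by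
  obtain ⟨s, hs⟩ := exists_section (φ := φ) (hι := hι)
  refine ⟨s, fun h hh => ContinuousAt.continuousWithinAt ?_,
    fun a ha => hs _ a ha (φ.map_mem_chart a)⟩
  obtain ⟨a, ha, hha⟩ := φ.exists_mem_chart hι φ.isOpen_domain hh
  refine (continuousAt_point hha continuousAt_id (continuousAt_const (y := φ a))).congr ?_
  filter_upwards [(φ.isOpen_chart a).mem_nhds hha] with k hk
  exact (hs k a ha hk).symm

variable (φ hι) in
/-- The point with coordinate `1` over `1`. -/
noncomputable def basepoint : φ.Cover hι := point φ hι 1 1 1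

theorem smul_basepoint (g : A × U) :
    g • basepoint φ hι = point φ hι g.1 (ι g.1) g.2 := by
  rw [basepoint, smul_point g (by simpa using φ.map_mem_chart 1)]
  simp only [mul_one]

theorem mem_pathComponentStabilizer_of_mem_domain (hφ : IsPathConnected φ.domain) {x : A}
    (hx : ι x ∈ φ.domain) : (x, φ x) ∈ pathComponentStabilizer (A × U) (basepoint φ hι) := by
  obtain ⟨s, hs, s_map⟩ := exists_continuousOn_section (φ := φ) (hι := hι)
  have joined := ((hφ.joinedIn (ι 1) (by simpa using φ.one_mem_domain) (ι x) hx).map_continuousOn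
    hs).joined
  rw [s_map 1 (by simpa using φ.one_mem_domain), s_map x hx, φ.map_one] at joined
  rw [mem_pathComponentStabilizer, smul_basepoint]
  simpa [basepoint] using joined

theorem eq_one_of_mem_pathComponentStabilizer [SimplyConnectedSpace H] {u : U}
    (hu : (1, u) ∈ pathComponentStabilizer (A × U) (basepoint φ hι)) : u = 1 := by
  rw [mem_pathComponentStabilizer, smul_basepoint] at hu
  have := eq_of_joined_of_isCoveringMap isCoveringMap_proj hu (by simp [basepoint, point])
  rw [basepoint, _root_.map_one] at this
  exact (point_injective 1 1 this).symm

end Cover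

end Covering

theorem exists_extension [SimplyConnectedSpace H] (hι : DenseRange ι)
    (hφ : IsPathConnected φ.domain) : ∃ F : A →* U, ∀ x, ι x ∈ φ.domain → F x = φ x := by
  let : TopologicalSpace U := ⊥
  have : DiscreteTopology U := ⟨rfl⟩
  set S := pathComponentStabilizer (A × U) (Cover.basepoint φ hι)
  have graph_mem : ∀ x, ι x ∈ φ.domain → (x, φ x) ∈ S := fun x =>
    Cover.mem_pathComponentStabilizer_of_mem_domain hφ
  have fst_injective : Function.Injective (Prod.fst ∘ S.subtype) := by
    refine (injective_iff_map_eq_one ((MonoidHom.fst A U).comp S.subtype)).2 ?_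
    rintro ⟨⟨_, u⟩, hu⟩ rfl
    exact Subtype.ext (Prod.ext rfl (Cover.eq_one_of_mem_pathComponentStabilizer hu))
  have fst_surjective : Function.Surjective (Prod.fst ∘ S.subtype) := by
    refine MonoidHom.range_eq_top (f := (MonoidHom.fst A U).comp S.subtype).1 <| eq_top_iff.2 ?_
    rw [← closure_preimage_eq_top_of_denseRange hι φ.isOpen_domain φ.one_mem_domain,
      Subgroup.closure_le]
    exact fun x hx => ⟨⟨(x, φ x), graph_mem x hx⟩, rfl⟩
  obtain ⟨F, hF⟩ := Subgroup.exists_eq_graph ⟨fst_injective, fst_surjective⟩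
  exact ⟨F, fun x hx => MonoidHom.mem_graph.1 (hF ▸ graph_mem x hx)⟩

end LocalGroupHom

theorem UniversalGroup.of_mul_of {S : Type*} [PartialMul S] {s t u : S}
    (h : u ∈ PartialMul.pmul s t) :
    (PresentedGroup.of s * PresentedGroup.of t : UniversalGroup S) = PresentedGroup.of u :=
  PresentedGroup.mk_eq_mk_of_mul_inv_mem (x := FreeGroup.of s * FreeGroup.of t)
    (y := FreeGroup.of u) ⟨s, t, u, h, rfl⟩

namespace PointSetSemigroup

open PointedPattern

variable {E : Type*} [AddCommGroup E] {D : Set E}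

/-- The class of a triple in the universal group. -/
def toUniversalGroup (x : PointedPattern D) : UniversalGroup (PointSetSemigroup D) :=
  PresentedGroup.of (mk x)

theorem toUniversalGroup_mul {x y z : PointedPattern D} (h : z ∈ comp x y) :
    toUniversalGroup x * toUniversalGroup y = toUniversalGroup z :=
  UniversalGroup.of_mul_of (mem_pmul_iff.2 ⟨x, y, z, rfl, rfl, h, rfl⟩)

theorem toUniversalGroup_eq_one {x : PointedPattern D} (h : x.left = x.right) :
    toUniversalGroup x = 1 := by
  have mul_self := toUniversalGroup_mul (x := x) (y := x) (z := x) (mem_comp_iff.2 (by simp [h]))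
  exact mul_eq_left.1 mul_self

/-- The triple `(p, {p, q}, q)`. -/
@[simps]
def pair (p q : D) : PointedPattern D where
  left := p
  pattern := {(p : E), (q : E)}
  right := q
  finite := by simp
  subset := by simp [Set.insert_subset_iff]
  left_mem := by simp
  right_mem := by simp

/-- The image in the universal group of the class of `(p, {p, q}, q)`. -/
def edge (p q : D) : UniversalGroup (PointSetSemigroup D) :=
  toUniversalGroup (pair p q)

-- `(p₂, P, p₁) = (p₂, {p₂, p₁}, p₁) (p₁, P, p₁)`, and the second factor is an idempotent.
theorem toUniversalGroup_eq_edge (x : PointedPattern D) :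
    toUniversalGroup x = edge ⟨x.left, x.subset x.left_mem⟩ ⟨x.right, x.subset x.right_mem⟩ := by
  let p : PointedPattern D := pair ⟨x.left, x.subset x.left_mem⟩ ⟨x.right, x.subset x.right_mem⟩
  let e : PointedPattern D := { x with left := x.right, left_mem := x.right_mem }
  have pattern_eq : x.pattern = p.pattern ∪ e.pattern :=
    (Set.union_eq_right.2 (by simp [p, Set.insert_subset_iff, x.left_mem, x.right_mem])).symm
  have mul_eq : toUniversalGroup p * toUniversalGroup e = toUniversalGroup x :=
    toUniversalGroup_mul (mem_comp_iff.2 ⟨rfl, rfl, pattern_eq, rfl⟩)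
  rw [← mul_eq, toUniversalGroup_eq_one (x := e) rfl, mul_one, edge]

theorem edge_mul_edge (p q r : D) : edge p q * edge q r = edge p r := by
  let x : PointedPattern D :=
    { left := p, pattern := {(p : E), (q : E)} ∪ {(q : E), (r : E)}, right := r
      finite := by simp
      subset := by simp [Set.insert_subset_iff]
      left_mem := by simp
      right_mem := by simp }
  calc edge p q * edge q r = toUniversalGroup x :=
        toUniversalGroup_mul (mem_comp_iff.2 ⟨rfl, rfl, rfl, rfl⟩)
    _ = edge p r := toUniversalGroup_eq_edge x

theorem edge_eq_of_sub_eq_sub {p q p' q' : D} (h : (p - q : E) = p' - q') :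
    edge p q = edge p' q' := by
  have right_eq : (p' - p + q : E) = q' := by rw [sub_add, h, sub_sub_cancel]
  refine congrArg PresentedGroup.of (mk_eq_iff.2 ⟨p' - p, mem_translate_iff.2 ⟨?_, ?_, ?_⟩⟩)
  · simp
  · simp [Set.vadd_set_insert, right_eq]
  · exact right_eq.symm

theorem closure_range_edge :
    Subgroup.closure (Set.range fun pq : D × D => edge pq.1 pq.2) = ⊤ := by
  rw [eq_top_iff, ← PresentedGroup.closure_range_of, Subgroup.closure_le]
  rintro _ ⟨s, rfl⟩
  obtain ⟨x, rfl⟩ := Quotient.exists_rep s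
  exact Subgroup.subset_closure ⟨(_, _), (toUniversalGroup_eq_edge x).symm⟩

/-- The map `[p₂, P, p₁] ↦ p₂ - p₁`. -/
def difference : PointSetSemigroup D → E :=
  Quotient.lift (fun x => x.left - x.right) (by
    rintro x y ⟨g, hg⟩
    obtain ⟨left_eq, -, right_eq⟩ := mem_translate_iff.1 hg
    simp only [left_eq, right_eq, add_sub_add_left_eq_sub])

theorem difference_mk (x : PointedPattern D) : difference (mk x) = x.left - x.right := rfl

theorem IsProd.difference_add {a b c : PointSetSemigroup D} (h : IsProd a b c) :
    difference a + difference b = difference c := by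
  obtain ⟨x, y, z, rfl, rfl, hz, rfl⟩ := h
  obtain ⟨right_eq_left, left_eq, -, right_eq⟩ := mem_comp_iff.1 hz
  rw [difference_mk, difference_mk, difference_mk, right_eq_left, left_eq, right_eq,
    sub_add_sub_cancel]

/-- The homomorphism from the universal group induced by `[p₂, P, p₁] ↦ p₂ - p₁`. -/
def displacement : UniversalGroup (PointSetSemigroup D) →* Multiplicative E :=
  PresentedGroup.toGroup (f := fun s => Multiplicative.ofAdd (difference s)) (by
    rintro _ ⟨_, _, _, h, rfl⟩
    simp [← (mem_pmul_iff.1 h).difference_add])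

theorem displacement_edge (p q : D) : displacement (edge p q) = Multiplicative.ofAdd (p - q : E) :=
  PresentedGroup.toGroup.of _

end PointSetSemigroup

namespace modelSet

open PointSetSemigroup

variable {E H : Type*} [AddCommGroup E] [AddCommGroup H] {Λ : AddSubgroup (E × H)} {K V : Set H}

/-- The point `π x` of the model set. -/
def point (x : Λ) (hx : x.1.2 ∈ K) : modelSet Λ K := ⟨x.1.1, x.1, x.2, hx, rfl⟩

theorem exists_eq_point (p : modelSet Λ K) : ∃ (x : Λ) (hx : x.1.2 ∈ K), p = point x hx := by
  obtain ⟨_, x, hx, hxK, rfl⟩ := p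
  exact ⟨⟨x, hx⟩, hxK, rfl⟩

open Classical in
/-- The class of `(π x, {π x, 0}, 0)` in the universal group if `π' x ∈ V`, with junk value `1`
otherwise. -/
noncomputable def edgeZero (Λ : AddSubgroup (E × H)) (hVK : V ⊆ K) (hV0 : 0 ∈ V) (x : Λ) :
    UniversalGroup (PointSetSemigroup (modelSet Λ K)) :=
  if hx : x.1.2 ∈ V then edge (point x (hVK hx)) (point 0 (hVK hV0)) else 1

variable (hVK : V ⊆ K) (hV0 : 0 ∈ V)

theorem edgeZero_of_mem {x : Λ} (hx : x.1.2 ∈ V) :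
    edgeZero Λ hVK hV0 x = edge (point x (hVK hx)) (point 0 (hVK hV0)) :=
  dif_pos hx

theorem edge_point {x y : Λ} (hx : x.1.2 ∈ K) (hy : y.1.2 ∈ K) (hxy : (x - y).1.2 ∈ V) :
    edge (point x hx) (point y hy) = edgeZero Λ hVK hV0 (x - y) := by
  rw [edgeZero_of_mem hVK hV0 hxy]
  exact edge_eq_of_sub_eq_sub (by simp [point])

theorem edgeZero_add {x y : Λ} (hx : x.1.2 ∈ V) (hy : y.1.2 ∈ V) (hxy : (x + y).1.2 ∈ V) :
    edgeZero Λ hVK hV0 (x + y) = edgeZero Λ hVK hV0 x * edgeZero Λ hVK hV0 y := by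
  have edge_eq := edge_point hVK hV0 (x := x + y) (hVK hxy) (hVK hy) (by simpa using hx)
  rw [add_sub_cancel_right] at edge_eq
  rw [edgeZero_of_mem hVK hV0 hxy, edgeZero_of_mem hVK hV0 hy, ← edge_eq, edge_mul_edge]

theorem displacement_edgeZero {x : Λ} (hx : x.1.2 ∈ V) :
    displacement (edgeZero Λ hVK hV0 x) = Multiplicative.ofAdd x.1.1 := by
  simp [edgeZero_of_mem hVK hV0 hx, displacement_edge, point]

/-- The projection `π'` on `Λ`, written multiplicatively. -/
abbrev internalProj (Λ : AddSubgroup (E × H)) : Multiplicative Λ →* Multiplicative H :=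
  ((AddMonoidHom.snd E H).comp Λ.subtype).toMultiplicative

variable [TopologicalSpace H]

/-- The local homomorphism `x ↦ [π x, {π x, 0}, 0]` to the universal group. -/
noncomputable def edgeLocalHom (Λ : AddSubgroup (E × H)) (hVK : V ⊆ K) (hV0 : 0 ∈ V)
    (hV : IsOpen V) :
    LocalGroupHom (internalProj Λ) (UniversalGroup (PointSetSemigroup (modelSet Λ K))) where
  domain := Multiplicative.toAdd ⁻¹' V
  isOpen_domain := hV
  one_mem_domain := hV0
  toFun x := edgeZero Λ hVK hV0 x.toAdd
  map_mul' _ _ := edgeZero_add hVK hV0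

variable [IsTopologicalAddGroup H]

theorem exists_sub_mem (hΛ : DenseRange fun x : Λ => x.1.2) (hV : IsOpen V)
    (hKV : K ⊆ ⋃ s ∈ V, s +ᵥ V) {x : Λ} (hx : x.1.2 ∈ K) :
    ∃ y : Λ, y.1.2 ∈ V ∧ (x - y).1.2 ∈ V := by
  obtain ⟨t, ht, v, hv, htv⟩ : ∃ t ∈ V, ∃ v ∈ V, t + v = x.1.2 := by
    simpa [Set.mem_add] using hKV hx
  exact hΛ.exists_mem_open (s := V ∩ (fun k => x.1.2 - k) ⁻¹' V)
    (hV.inter (hV.preimage (by fun_prop))) ⟨t, ht, by simpa [← htv]⟩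

theorem closure_image_edgeZero (hΛ : DenseRange fun x : Λ => x.1.2) (hV : IsOpen V)
    (hKV : K ⊆ ⋃ s ∈ V, s +ᵥ V) :
    Subgroup.closure (edgeZero Λ hVK hV0 '' {x | x.1.2 ∈ V}) = ⊤ := by
  set C := Subgroup.closure (edgeZero Λ hVK hV0 '' {x | x.1.2 ∈ V})
  have edgeZero_mem : ∀ x : Λ, x.1.2 ∈ V → edgeZero Λ hVK hV0 x ∈ C := fun x hx =>
    Subgroup.subset_closure ⟨x, hx, rfl⟩
  have edge_zero_mem : ∀ p : modelSet Λ K, edge p (point 0 (hVK hV0)) ∈ C := by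
    intro p
    obtain ⟨x, hx, rfl⟩ := exists_eq_point p
    obtain ⟨y, hy, hxy⟩ := exists_sub_mem hΛ hV hKV hx
    rw [← edge_mul_edge _ (point y (hVK hy)), edge_point hVK hV0 hx (hVK hy) hxy,
      ← edgeZero_of_mem hVK hV0 hy]
    exact C.mul_mem (edgeZero_mem _ hxy) (edgeZero_mem _ hy)
  rw [eq_top_iff, ← closure_range_edge, Subgroup.closure_le]
  rintro _ ⟨⟨p, q⟩, rfl⟩
  have edge_eq : edge p q = edge p (point 0 (hVK hV0)) * (edge q (point 0 (hVK hV0)))⁻¹ := by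
    rw [eq_mul_inv_iff_mul_eq, edge_mul_edge]
  change edge p q ∈ C
  rw [edge_eq]
  exact C.mul_mem (edge_zero_mem p) (C.inv_mem (edge_zero_mem q))

theorem exists_monoidHom_eq_edgeZero [SimplyConnectedSpace H] (hΛ : DenseRange fun x : Λ => x.1.2)
    (hV : IsOpen V) (hV_path : IsPathConnected V) :
    ∃ F : Multiplicative Λ →* UniversalGroup (PointSetSemigroup (modelSet Λ K)),
      ∀ x : Λ, x.1.2 ∈ V → F (.ofAdd x) = edgeZero Λ hVK hV0 x :=
  have : SimplyConnectedSpace (Multiplicative H) := ‹SimplyConnectedSpace H›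
  (edgeLocalHom Λ hVK hV0 hV).exists_extension hΛ hV_path

theorem nonempty_mulEquiv_universalGroup [SimplyConnectedSpace H]
    (h_fst : Set.InjOn (fun x : E × H => x.1) Λ) (hΛ : DenseRange fun x : Λ => x.1.2)
    (hVK : V ⊆ K) (hV0 : 0 ∈ V) (hV : IsOpen V) (hV_path : IsPathConnected V)
    (hKV : K ⊆ ⋃ s ∈ V, s +ᵥ V) :
    Nonempty (Multiplicative Λ ≃* UniversalGroup (PointSetSemigroup (modelSet Λ K))) := by
  have : ConnectedSpace (Multiplicative H) := inferInstanceAs (ConnectedSpace H)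
  obtain ⟨F, hF⟩ := exists_monoidHom_eq_edgeZero hVK hV0 hΛ hV hV_path
  have F_surjective : Function.Surjective F := by
    rw [← MonoidHom.range_eq_top, eq_top_iff, ← closure_image_edgeZero hVK hV0 hΛ hV hKV,
      Subgroup.closure_le]
    rintro _ ⟨x, hx, rfl⟩
    exact ⟨.ofAdd x, hF x hx⟩
  have displacement_comp_F :
      displacement.comp F = ((AddMonoidHom.fst E H).comp Λ.subtype).toMultiplicative :=
    MonoidHom.eq_of_eqOn_dense
      (closure_preimage_eq_top_of_denseRange (ι := internalProj Λ) hΛ hV hV0) fun x hx =>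
        (congrArg displacement (hF x.toAdd hx)).trans (displacement_edgeZero hVK hV0 hx)
  have F_injective : Function.Injective F := by
    refine Function.Injective.of_comp (f := displacement) ?_
    rw [← MonoidHom.coe_comp, displacement_comp_F]
    exact fun x y hxy => Subtype.ext (h_fst x.2 y.2 hxy)
  exact ⟨MulEquiv.ofBijective F ⟨F_injective, F_surjective⟩⟩

end modelSet

theorem theorem3p4p5_general {E H : Type*} [AddCommGroup E] [AddCommGroup H] [TopologicalSpace H]
    [IsTopologicalAddGroup H] [SimplyConnectedSpace H] (Λ : AddSubgroup (E × H)) (K : Set H)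
    (h_fst : Set.InjOn (fun x : E × H => x.1) Λ) (h_snd : Set.InjOn (fun x : E × H => x.2) Λ)
    (G : AddSubgroup H) (hG : G = Λ.map (AddMonoidHom.snd E H)) (hG_dense : Dense (G : Set H))
    (V : Set H) (hV_open : IsOpen V) (hV_path : IsPathConnected V) (hV_zero : 0 ∈ V)
    (hVK : V ⊆ K) (hKV : K ⊆ ⋃ s ∈ V, s +ᵥ V) :
    Nonempty (UniversalGroup (PointSetSemigroup (modelSet Λ K)) ≃* Multiplicative G) := by
  set proj : Λ →+ H := (AddMonoidHom.snd E H).comp Λ.subtype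
  have range_proj : proj.range = G := by
    rw [hG, AddMonoidHom.range_comp, AddSubgroup.range_subtype]
  have denseRange_proj : DenseRange proj := by
    rwa [DenseRange, ← AddMonoidHom.coe_range, range_proj]
  have proj_injective : Function.Injective proj := fun x y h => Subtype.ext (h_snd x.2 y.2 h)
  obtain ⟨e⟩ := modelSet.nonempty_mulEquiv_universalGroup h_fst denseRange_proj hVK hV_zero hV_open
    hV_path hKV
  exact ⟨e.symm.trans (AddEquiv.toMultiplicative
    ((AddMonoidHom.ofInjective proj_injective).trans (AddEquiv.addSubgroupCongr range_proj)))⟩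

/-- The group `H` is written additively. -/
theorem theorem3p4p5 (d : ℕ) {H : Type*} [AddCommGroup H] [TopologicalSpace H]
    [IsTopologicalAddGroup H] [T2Space H] [LocallyCompactSpace H] [SimplyConnectedSpace H]
    (Λ : AddSubgroup (EuclideanSpace ℝ (Fin d) × H))
    (hΛ : CompactSpace ((EuclideanSpace ℝ (Fin d) × H) ⧸ Λ))
    (K : Set H) (hK_nonempty : K.Nonempty) (hK_bounded : IsCompact (closure K))
    (h_fst : Set.InjOn (fun x : EuclideanSpace ℝ (Fin d) × H => x.1) Λ)
    (h_snd : Set.InjOn (fun x : EuclideanSpace ℝ (Fin d) × H => x.2) Λ)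
    (G : AddSubgroup H) (hG : G = Λ.map (AddMonoidHom.snd (EuclideanSpace ℝ (Fin d)) H))
    (hG_dense : Dense (G : Set H))
    (hK : K = closure (interior K))
    (V : Set H) (hV_open : IsOpen V) (hV_path : IsPathConnected V) (hV_zero : 0 ∈ V)
    (hVK : V ⊆ K) (hKV : K ⊆ ⋃ s ∈ V, s +ᵥ V) :
    Nonempty (UniversalGroup (PointSetSemigroup (modelSet Λ K)) ≃* Multiplicative G) :=
  theorem3p4p5_general Λ K h_fst h_snd G hG hG_dense V hV_open hV_path hV_zero hVK hKV
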